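/- All graphs are finite, and $\mathrm{td}$ denotes treedepth: $\mathrm{td}(G)$ is the minimum height (maximum number of vertices on a root-to-leaf path) of a rooted forest $F$ for which there is an injective map $f:V(G)\to V(F)$ such that $f(u),f(v)$ are in ancestor-descendant relation in $F$ for every $uv\in E(G)$. A tree decomposition of a graph $G$ is a pair $(T,\beta)$, where $T$ is a rooted tree and $\beta:V(T)\to 2^{V(G)}$ is such that for every $v\in V(G)$ the set $\{t\in V(T) : v\in\beta(t)\}$ induces a nonempty connected subtree of $T$, and for every $uv\in E(G)$ there is $t\in V(T)$ with $u,v\in\beta(t)$. Every node counts as an ancestor and as a descendant of itself. A tree decomposition $(T,\beta)$ of $G$ is greedy if 1. $V(T)=V(G)$, where each vertex $v$ of $G$ is identified with the topmost node whose bag contains $v$; that is, $v\in\beta(v)$, and $v\in\beta(t)$ implies that $v$ is an ancestor of $t$ in $T$; 2. for every $uv\in E(G)$, the nodes $u$ and $v$ are in ancestor-descendant relation in $T$; and 3. for every $u\in V(T)$ and every child $v$ of $u$ in $T$ there is a descendant $w$ of $v$ in $T$ such that $uw\in E(G)$. Statement. There is an absolute constant $c>0$ such that the following holds. Let $G$ be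 a connected graph, let $(T,\beta)$ be a greedy tree decomposition of $G$, and let $\tau\ge 2$ be a real number such that $|\beta(t)|\le\tau$ for every $t\in V(T)$. Then $G$ contains, as a (not necessarily induced) subgraph, a tree $H$ of maximum degree at most $3$ with $$\mathrm{td}(H)\ \ge\ c\cdot\frac{\mathrm{td}(T)}{\log_2\tau}.$$ -/

import Mathlib

universe u v

/-- A rooted forest on the vertex set `W`, presented by its ancestor relation: `anc a d` says that
`a` is an ancestor of `d` (every vertex being an ancestor of itself). The ancestors of any given
vertex form a chain. -/
structure RootedForest (W : Type u) where
  anc : W → W → Prop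
  anc_refl : ∀ a, anc a a
  anc_antisymm : ∀ a b, anc a b → anc b a → a = b
  anc_trans : ∀ a b c, anc a b → anc b c → anc a c
  anc_chain : ∀ a b d, anc a d → anc b d → anc a b ∨ anc b a

/-- The height of a (finite) rooted forest: the largest number of vertices on a path from a root
down to a vertex `d`, that is, the largest number of ancestors of a vertex `d` (itself included).
The empty forest has height `0`. -/
noncomputable def RootedForest.height {W : Type u} (F : RootedForest W) : ℕ :=
  ⨆ d : W, {a : W | F.anc a d}.ncard

namespace SimpleGraph

/-- `(F, f)` is a treedepth decomposition of `G`: the map `f` from the vertices of `G` to the nodes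
of the rooted forest `F` is injective, and adjacent vertices of `G` are sent to nodes in
ancestor-descendant relation. -/
def IsTreedepthDecomposition {V : Type u} (G : SimpleGraph V) {W : Type v} (F : RootedForest W)
    (f : V → W) : Prop :=
  Function.Injective f ∧ ∀ x y : V, G.Adj x y → F.anc (f x) (f y) ∨ F.anc (f y) (f x)

/-- The treedepth of a finite graph: the minimum height of a treedepth decomposition. -/
noncomputable def treedepth {V : Type u} (G : SimpleGraph V) : ℕ :=
  sInf {k : ℕ | ∃ (W : Type u) (_ : Finite W) (F : RootedForest W) (f : V → W),
    G.IsTreedepthDecomposition F f ∧ F.height = k}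

/-- A tree decomposition of `G`, with a rooted tree whose set of nodes is `N`. -/
structure TreeDecomposition {V : Type u} (G : SimpleGraph V) (N : Type v) where
  tree : SimpleGraph N
  root : N
  bag : N → Finset V
  isTree : tree.IsTree
  /-- The nodes whose bags contain `x` induce a nonempty connected subgraph of the tree. -/
  connected_bags : ∀ x : V, (tree.induce {t : N | x ∈ bag t}).Connected
  exists_bag_of_adj : ∀ x y : V, G.Adj x y → ∃ t : N, x ∈ bag t ∧ y ∈ bag t

namespace TreeDecomposition

variable {V : Type u} {G : SimpleGraph V} {N : Type v}

/-- The node `a` is an ancestor of `d` (possibly `a = d`): it lies on the path from the root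
to `d`. -/
def IsAncestor (D : G.TreeDecomposition N) (a d : N) : Prop :=
  ∃ p : D.tree.Walk D.root d, p.IsPath ∧ a ∈ p.support

/-- The node `b` is a child of the node `a`. -/
def IsChild (D : G.TreeDecomposition N) (b a : N) : Prop :=
  D.tree.Adj a b ∧ D.IsAncestor a b

/-- A greedy tree decomposition of `G`. The nodes of the tree are the vertices of `G`
(so the type of nodes is `V`), where a vertex `x` is identified with the topmost of the nodes whose
bags contain `x`. -/
structure IsGreedy (D : G.TreeDecomposition V) : Prop where
  mem_bag_self : ∀ x : V, x ∈ D.bag x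
  isAncestor_of_mem_bag : ∀ x t : V, x ∈ D.bag t → D.IsAncestor x t
  isAncestor_or_of_adj : ∀ x y : V, G.Adj x y → D.IsAncestor x y ∨ D.IsAncestor y x
  exists_adj_of_isChild : ∀ x y : V, D.IsChild y x → ∃ z : V, D.IsAncestor y z ∧ G.Adj x z

end TreeDecomposition

end SimpleGraph

/-!
Each node of `T` has, for every child, an edge of `G` into the subtree of that child. One such edge
per child gives a spanning tree `S` of `G` in which the vertex set of every subtree of `T` is
connected.

If a connected part `A` of `T` is attached to the rest of `T` through at most three of its nodes,
then each component of `S[A]` meets the bag of one of these nodes or contains the top of `A`. Hence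
at most `3 τ + 1` vertices suffice to decrease the treedepth of `S[A]`. Balanced separators of the
tree `T` isolate them in depth `log₂ τ + O(1)`, into parts attached through at most three nodes
again, so `td(T) = O(td(S) log τ)` by induction on `td(S[A])`.

Finally a tree `S` contains a subcubic subtree of at least half its treedepth: some edge splits `S`
into two parts of almost full treedepth, subcubic subtrees are found recursively in both parts, with
the ends of the removed edges prescribed, and joining two of them by the edge adds one to the
treedepth.
-/

namespace RootedForest

variable {V W : Type*}

lemma ncard_le_height [Finite W] (F : RootedForest W) (d : W) :
    {a | F.anc a d}.ncard ≤ F.height :=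
  le_ciSup (f := fun d => {a | F.anc a d}.ncard) (Set.toFinite _).bddAbove d

lemma height_le {F : RootedForest W} {n : ℕ} (h : ∀ d, {a | F.anc a d}.ncard ≤ n) :
    F.height ≤ n :=
  ciSup_le' h

/-- The forest consisting of a single path, in the order of `W`. -/
def ofLinearOrder (W : Type*) [LinearOrder W] : RootedForest W where
  anc := (· ≤ ·)
  anc_refl := le_refl
  anc_antisymm _ _ := le_antisymm
  anc_trans _ _ _ := le_trans
  anc_chain a b _ _ _ := le_total a b

/-- The forest order pulled back along an injective map. -/
def comap (F : RootedForest W) (f : V → W) (hf : Function.Injective f) : RootedForest V where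
  anc a d := F.anc (f a) (f d)
  anc_refl a := F.anc_refl (f a)
  anc_antisymm _ _ hab hba := hf (F.anc_antisymm _ _ hab hba)
  anc_trans _ _ _ := F.anc_trans _ _ _
  anc_chain _ _ _ := F.anc_chain _ _ _

/-- A forest on a set `A` of vertices, with every vertex outside `A` added as an isolated root. -/
def extend {A : Set V} (F : RootedForest A) : RootedForest V where
  anc a d := a = d ∨ ∃ (ha : a ∈ A) (hd : d ∈ A), F.anc ⟨a, ha⟩ ⟨d, hd⟩
  anc_refl _ := Or.inl rfl
  anc_antisymm := by
    rintro a b (rfl | ⟨ha, hb, hab⟩) (hba | ⟨_, _, hba⟩)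
    · rfl
    · rfl
    · exact hba.symm
    · exact congrArg Subtype.val (F.anc_antisymm _ _ hab hba)
  anc_trans := by
    rintro a b c (rfl | ⟨ha, hb, hab⟩) (rfl | ⟨hb', hc, hbc⟩)
    · exact Or.inl rfl
    · exact Or.inr ⟨hb', hc, hbc⟩
    · exact Or.inr ⟨ha, hb, hab⟩
    · exact Or.inr ⟨ha, hc, F.anc_trans _ _ _ hab hbc⟩
  anc_chain := by
    rintro a b d (rfl | ⟨ha, hd, had⟩) (rfl | ⟨hb, hd', hbd⟩)
    · exact Or.inl (Or.inl rfl)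
    · exact Or.inr (Or.inr ⟨hb, hd', hbd⟩)
    · exact Or.inl (Or.inr ⟨ha, hd, had⟩)
    · exact (F.anc_chain _ _ _ had hbd).imp (fun h => Or.inr ⟨ha, hb, h⟩)
        fun h => Or.inr ⟨hb, ha, h⟩

/-- The forest with `x` moved to the top, as the only root. -/
def addRoot (F : RootedForest V) (x : V) : RootedForest V where
  anc a d := a = x ∨ d ≠ x ∧ F.anc a d
  anc_refl a := or_iff_not_imp_left.mpr fun ha => ⟨ha, F.anc_refl a⟩
  anc_antisymm := by
    rintro a b (rfl | ⟨hb, hab⟩) (rfl | ⟨ha, hba⟩)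
    · rfl
    · exact absurd rfl ha
    · exact absurd rfl hb
    · exact F.anc_antisymm _ _ hab hba
  anc_trans := by
    rintro a b c (rfl | ⟨hb, hab⟩) (rfl | ⟨hc, hbc⟩)
    · exact Or.inl rfl
    · exact Or.inl rfl
    · exact absurd rfl hb
    · exact Or.inr ⟨hc, F.anc_trans _ _ _ hab hbc⟩
  anc_chain := by
    rintro a b d (rfl | ⟨hd, had⟩) hb
    · exact Or.inl (Or.inl rfl)
    rcases hb with rfl | ⟨-, hbd⟩
    · exact Or.inr (Or.inl rfl)
    by_cases ha : a = x
    · exact Or.inl (Or.inl ha)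
    by_cases hb : b = x
    · exact Or.inr (Or.inl hb)
    · exact (F.anc_chain _ _ _ had hbd).imp (fun h => Or.inr ⟨hb, h⟩) fun h => Or.inr ⟨ha, h⟩

/-- The disjoint union of forests on the fibres of `κ`: the fibre over `k` is ordered by `F k`. -/
def glue {K : Type*} (κ : V → K) (F : K → RootedForest V) : RootedForest V where
  anc a d := κ a = κ d ∧ (F (κ a)).anc a d
  anc_refl a := ⟨rfl, (F (κ a)).anc_refl a⟩
  anc_antisymm a b hab hba := (F (κ a)).anc_antisymm _ _ hab.2 (hab.1 ▸ hba.2)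
  anc_trans a b c hab hbc :=
    ⟨hab.1.trans hbc.1, (F (κ a)).anc_trans _ _ _ hab.2 (hab.1 ▸ hbc.2)⟩
  anc_chain a b d had hbd := by
    have hab : κ a = κ b := had.1.trans hbd.1.symm
    exact ((F (κ a)).anc_chain a b d had.2 (hab ▸ hbd.2)).imp (fun h => ⟨hab, h⟩)
      fun h => ⟨hab.symm, hab ▸ h⟩

end RootedForest

namespace GreedyTreedepth

open SimpleGraph

section Connectivity

variable {V : Type*} {G : SimpleGraph V} {A B C : Set V} {x y z : V}

lemma exists_adj_of_induce_connected (hA : (G.induce A).Connected) (hAB : (A ∩ B).Nonempty)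
    (h : ¬ A ⊆ B) : ∃ a ∈ A ∩ B, ∃ b ∈ A \ B, G.Adj a b := by
  obtain ⟨x, hxA, hxB⟩ := hAB
  obtain ⟨y, hyA, hyB⟩ := Set.not_subset.mp h
  obtain ⟨p⟩ := hA.preconnected ⟨x, hxA⟩ ⟨y, hyA⟩
  obtain ⟨d, -, hd, hd'⟩ := p.exists_boundary_dart (Subtype.val ⁻¹' B) hxB hyB
  exact ⟨d.fst, ⟨d.fst.2, hd⟩, d.snd, ⟨d.snd.2, hd'⟩, d.adj⟩

lemma subset_of_induce_connected (hA : (G.induce A).Connected) (hxA : x ∈ A) (hxB : x ∈ B)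
    (hB : ∀ a ∈ A ∩ B, ∀ b ∈ A, G.Adj a b → b ∈ B) : A ⊆ B := by
  by_contra h
  obtain ⟨a, ha, b, ⟨hbA, hbB⟩, hab⟩ := exists_adj_of_induce_connected hA ⟨x, hxA, hxB⟩ h
  exact hbB (hB a ha b hbA hab)

lemma nonempty_of_induce_connected (hA : (G.induce A).Connected) : A.Nonempty :=
  Set.nonempty_coe_sort.mp hA.nonempty

lemma induce_connected_union (hA : (G.induce A).Connected) (hB : (G.induce B).Connected)
    (h : (A ∩ B).Nonempty) : (G.induce (A ∪ B)).Connected :=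
  induce_union_connected hA.preconnected hB.preconnected h

lemma induce_connected_union_of_adj (hA : (G.induce A).Connected) (hB : (G.induce B).Connected)
    (hx : x ∈ A) (hy : y ∈ B) (hxy : G.Adj x y) : (G.induce (A ∪ B)).Connected :=
  connected_induce_union hA.preconnected hB.preconnected hx hy hxy

lemma induce_connected_insert (hA : (G.induce A).Connected) (hx : x ∈ A) (hxy : G.Adj x y) :
    (G.induce (insert y A)).Connected :=
  induce_connected_union_of_adj (A := {y}) Connected.of_subsingleton hA rfl hx hxy.symm

lemma induce_connected_mono_graph {G' : SimpleGraph V} (hG : G ≤ G')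
    (hA : (G.induce A).Connected) : (G'.induce A).Connected :=
  hA.mono fun _ _ h => hG h

lemma induce_univ_connected (hG : G.Connected) : (G.induce Set.univ).Connected :=
  (Iso.connected_iff (induceUnivIso G)).mpr hG

/-- The connected component of `x` in the subgraph of `G` induced by `A`, as a set of vertices of
`G`. It is encoded as a union of connected sets, so that no subtypes occur, and is empty
for `x ∉ A`. -/
def componentIn (G : SimpleGraph V) (A : Set V) (x : V) : Set V :=
  {y | ∃ C ⊆ A, (G.induce C).Connected ∧ x ∈ C ∧ y ∈ C}

lemma componentIn_subset : componentIn G A x ⊆ A :=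
  fun _ ⟨_, hCA, _, _, hy⟩ => hCA hy

lemma mem_componentIn_self (hx : x ∈ A) : x ∈ componentIn G A x :=
  ⟨{x}, Set.singleton_subset_iff.mpr hx, Connected.of_subsingleton, rfl, rfl⟩

lemma subset_componentIn (hC : (G.induce C).Connected) (hCA : C ⊆ A) (hx : x ∈ C) :
    C ⊆ componentIn G A x :=
  fun _ hy => ⟨C, hCA, hC, hx, hy⟩

lemma induce_componentIn_connected (hx : x ∈ A) : (G.induce (componentIn G A x)).Connected := by
  have hunion : componentIn G A x = ⋃₀ {C | C ⊆ A ∧ (G.induce C).Connected ∧ x ∈ C} := by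
    ext y
    simp [componentIn, and_assoc]
  rw [hunion]
  exact induce_sUnion_connected_of_pairwise_not_disjoint
    ⟨{x}, Set.singleton_subset_iff.mpr hx, Connected.of_subsingleton, rfl⟩
    (fun hs ht => ⟨x, hs.2.2, ht.2.2⟩) fun hs => hs.2.1

lemma componentIn_eq_of_mem (hy : y ∈ componentIn G A x) :
    componentIn G A y = componentIn G A x := by
  obtain ⟨C, hCA, hC, hxC, hyC⟩ := hy
  have hcomp : ∀ {u v}, u ∈ C → v ∈ C → componentIn G A u ⊆ componentIn G A v := by
    rintro u v hu hv z ⟨C', hC'A, hC', huC', hzC'⟩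
    exact ⟨C ∪ C', Set.union_subset hCA hC'A, induce_connected_union hC hC' ⟨u, hu, huC'⟩,
      Or.inl hv, Or.inr hzC'⟩
  exact (hcomp hyC hxC).antisymm (hcomp hxC hyC)

lemma mem_componentIn_of_adj (hy : y ∈ componentIn G A x) (hz : z ∈ A) (hyz : G.Adj y z) :
    z ∈ componentIn G A x := by
  obtain ⟨C, hCA, hC, hxC, hyC⟩ := hy
  exact ⟨insert z C, Set.insert_subset hz hCA, induce_connected_insert hC hyC hyz,
    Or.inr hxC, Or.inl rfl⟩

lemma exists_forall_anc [Finite V] (F : RootedForest V) (hA : (G.induce A).Connected)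
    (hF : ∀ a ∈ A, ∀ b ∈ A, G.Adj a b → F.anc a b ∨ F.anc b a) :
    ∃ r ∈ A, ∀ a ∈ A, F.anc r a := by
  obtain ⟨r, hrA, hmin⟩ := Set.exists_min_image A (fun a => {b | F.anc b a}.ncard) A.toFinite
    (nonempty_of_induce_connected hA)
  have hr : ∀ a ∈ A, F.anc a r → a = r := by
    intro a ha har
    by_contra hne
    refine (hmin a ha).not_gt (Set.ncard_lt_ncard ⟨fun b hb => F.anc_trans _ _ _ hb har, ?_⟩)
    exact fun hsub => hne (F.anc_antisymm _ _ har (hsub (F.anc_refl r)))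
  refine ⟨r, hrA, subset_of_induce_connected hA hrA (F.anc_refl r) fun a ⟨ha, hra⟩ b hb hab => ?_⟩
  rcases hF a ha b hb hab with h | h
  · exact F.anc_trans _ _ _ hra h
  · rcases F.anc_chain _ _ _ hra h with h' | h'
    · exact h'
    · exact hr b hb h' ▸ F.anc_refl b

end Connectivity

section Treedepth

variable {V : Type u} {G : SimpleGraph V} {A B C : Set V} {n : ℕ}

lemma exists_isTreedepthDecomposition_height_eq [Finite V] (G : SimpleGraph V) :
    ∃ (W : Type u) (_ : Finite W) (F : RootedForest W) (f : V → W),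
      G.IsTreedepthDecomposition F f ∧ F.height = G.treedepth := by
  classical
  let _ : LinearOrder V := linearOrderOfSTO WellOrderingRel
  exact Nat.sInf_mem (s := {k | ∃ (W : Type u) (_ : Finite W) (F : RootedForest W) (f : V → W),
      G.IsTreedepthDecomposition F f ∧ F.height = k})
    ⟨_, V, inferInstance, .ofLinearOrder V, id,
      ⟨Function.injective_id, fun x y _ => le_total x y⟩, rfl⟩

lemma treedepth_le_of_injective {V' : Type u} [Finite V'] {G' : SimpleGraph V'} (f : G →g G')
    (hf : Function.Injective f) : G.treedepth ≤ G'.treedepth := by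
  obtain ⟨W, hW, F, g, ⟨hg, hF⟩, hheight⟩ := exists_isTreedepthDecomposition_height_eq G'
  exact Nat.sInf_le
    ⟨W, hW, F, g ∘ f, ⟨hg.comp hf, fun x y h => hF _ _ (f.map_adj h)⟩, hheight⟩

variable [Finite V]

lemma treedepth_induce_mono (h : A ⊆ B) : (G.induce A).treedepth ≤ (G.induce B).treedepth :=
  treedepth_le_of_injective (induceHomOfLE G h).toHom (Set.inclusion_injective h)

lemma treedepth_induce_univ : (G.induce Set.univ).treedepth = G.treedepth :=
  (treedepth_le_of_injective (induceUnivIso G).toHom (induceUnivIso G).injective).antisymm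
    (treedepth_le_of_injective (induceUnivIso G).symm.toHom (induceUnivIso G).symm.injective)

/-- `F` is a treedepth decomposition of height at most `n` of the subgraph of `G` induced by `A`.
The forest lives on all of `V`, and only its restriction to `A` matters. -/
structure IsEliminationForest (G : SimpleGraph V) (A : Set V) (n : ℕ) (F : RootedForest V) :
    Prop where
  anc_or_anc : ∀ x ∈ A, ∀ y ∈ A, G.Adj x y → F.anc x y ∨ F.anc y x
  ncard_le : ∀ d ∈ A, {a ∈ A | F.anc a d}.ncard ≤ n

lemma IsEliminationForest.treedepth_induce_le {F : RootedForest V}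
    (hF : IsEliminationForest G A n F) : (G.induce A).treedepth ≤ n := by
  have hheight : (F.comap ((↑) : A → V) Subtype.val_injective).height ≤ n :=
    RootedForest.height_le fun d =>
      (Set.ncard_le_ncard_of_injOn (t := {a ∈ A | F.anc a d}) Subtype.val (fun a ha => ⟨a.2, ha⟩)
        Subtype.val_injective.injOn).trans (hF.ncard_le d d.2)
  refine le_trans (Nat.sInf_le ?_) hheight
  exact ⟨A, inferInstance, _, id,
    ⟨Function.injective_id, fun x y h => hF.anc_or_anc x x.2 y y.2 h⟩, rfl⟩

lemma exists_isEliminationForest (G : SimpleGraph V) (A : Set V) :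
    ∃ F, IsEliminationForest G A (G.induce A).treedepth F := by
  obtain ⟨W, _, F, f, ⟨hf, hF⟩, hheight⟩ := exists_isTreedepthDecomposition_height_eq (G.induce A)
  refine ⟨(F.comap f hf).extend, fun x hx y hy hxy => ?_, fun d hd => ?_⟩
  · exact (hF ⟨x, hx⟩ ⟨y, hy⟩ hxy).imp (fun h => Or.inr ⟨hx, hy, h⟩) fun h => Or.inr ⟨hy, hx, h⟩
  · have himage : {a ∈ A | (F.comap f hf).extend.anc a d} ⊆
        Subtype.val '' (f ⁻¹' {w | F.anc w (f ⟨d, hd⟩)}) := by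
      rintro a ⟨ha, rfl | ⟨_, _, h⟩⟩
      exacts [⟨⟨a, ha⟩, F.anc_refl _, rfl⟩, ⟨⟨a, ha⟩, h, rfl⟩]
    calc _ ≤ (Subtype.val '' (f ⁻¹' {w | F.anc w (f ⟨d, hd⟩)})).ncard := Set.ncard_le_ncard himage
      _ ≤ (f ⁻¹' {w | F.anc w (f ⟨d, hd⟩)}).ncard := Set.ncard_image_le
      _ ≤ {w | F.anc w (f ⟨d, hd⟩)}.ncard :=
        Set.ncard_le_ncard_of_injOn f (fun _ h => h) hf.injOn
      _ ≤ F.height := F.ncard_le_height _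
      _ = (G.induce A).treedepth := hheight

lemma treedepth_induce_le_diff_singleton_add_one (x : V) :
    (G.induce A).treedepth ≤ (G.induce (A \ {x})).treedepth + 1 := by
  obtain ⟨F, hF⟩ := exists_isEliminationForest G (A \ {x})
  refine IsEliminationForest.treedepth_induce_le (F := F.addRoot x)
    ⟨fun y hy z hz hyz => ?_, fun d hd => ?_⟩
  · by_cases hyx : y = x
    · exact Or.inl (Or.inl hyx)
    by_cases hzx : z = x
    · exact Or.inr (Or.inl hzx)
    exact (hF.anc_or_anc y ⟨hy, hyx⟩ z ⟨hz, hzx⟩ hyz).imp (fun h => Or.inr ⟨hzx, h⟩)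
      fun h => Or.inr ⟨hyx, h⟩
  · by_cases hdx : d = x
    · have hsub : {a ∈ A | (F.addRoot x).anc a d} ⊆ {x} :=
        fun a ⟨_, ha⟩ => ha.resolve_right fun h => h.1 hdx
      exact (Set.ncard_le_ncard hsub).trans (by simp)
    · have hsub : {a ∈ A | (F.addRoot x).anc a d} ⊆ insert x {a ∈ A \ {x} | F.anc a d} := by
        rintro a ⟨ha, had⟩
        by_cases hax : a = x
        · exact Or.inl hax
        · exact Or.inr ⟨⟨ha, hax⟩, (had.resolve_left hax).2⟩
      calc _ ≤ _ := Set.ncard_le_ncard hsub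
        _ ≤ _ := Set.ncard_insert_le _ _
        _ ≤ _ := Nat.add_le_add_right (hF.ncard_le d ⟨hd, hdx⟩) 1

lemma treedepth_induce_le_of_componentIn
    (h : ∀ x ∈ A, (G.induce (componentIn G A x)).treedepth ≤ n) : (G.induce A).treedepth ≤ n := by
  choose F hF using exists_isEliminationForest G
  refine IsEliminationForest.treedepth_induce_le (F := .glue (componentIn G A) F)
    ⟨fun x hx y hy hxy => ?_, fun d hd => ?_⟩
  · have hyx : y ∈ componentIn G A x := mem_componentIn_of_adj (mem_componentIn_self hx) hy hxy
    have heq := componentIn_eq_of_mem hyx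
    exact ((hF (componentIn G A x)).anc_or_anc x (mem_componentIn_self hx) y hyx hxy).imp
      (fun h => ⟨heq.symm, h⟩) fun h => ⟨heq, heq ▸ h⟩
  · have hsub : {a ∈ A | (RootedForest.glue (componentIn G A) F).anc a d} ⊆
        {a ∈ componentIn G A d | (F (componentIn G A d)).anc a d} := by
      rintro a ⟨ha, heq, had⟩
      exact ⟨heq ▸ mem_componentIn_self ha, heq ▸ had⟩
    calc _ ≤ _ := Set.ncard_le_ncard hsub
      _ ≤ _ := (hF _).ncard_le d (mem_componentIn_self hd)
      _ ≤ n := h d hd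

lemma exists_treedepth_induce_diff_singleton_lt (hA : (G.induce A).Connected) :
    ∃ x ∈ A, (G.induce (A \ {x})).treedepth < (G.induce A).treedepth := by
  obtain ⟨F, hF⟩ := exists_isEliminationForest G A
  obtain ⟨x, hx, htop⟩ := exists_forall_anc F hA hF.anc_or_anc
  have hlt : ∀ d ∈ A, {a ∈ A \ {x} | F.anc a d}.ncard < (G.induce A).treedepth := by
    refine fun d hd => lt_of_lt_of_le (Set.ncard_lt_ncard ?_) (hF.ncard_le d hd)
    exact ⟨fun a ha => ⟨ha.1.1, ha.2⟩, fun hsub => (hsub (a := x) ⟨hx, htop d hd⟩).1.2 rfl⟩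
  have hle : (G.induce (A \ {x})).treedepth ≤ (G.induce A).treedepth - 1 :=
    IsEliminationForest.treedepth_induce_le (F := F)
      ⟨fun y hy z hz => hF.anc_or_anc y hy.1 z hz.1, fun d hd => Nat.le_pred_of_lt (hlt d hd.1)⟩
  exact ⟨x, hx, hle.trans_lt (Nat.pred_lt_of_lt (hlt x hx))⟩

lemma treedepth_induce_pos (hA : A.Nonempty) : 0 < (G.induce A).treedepth := by
  obtain ⟨x, hx⟩ := hA
  have hconn : (G.induce {x}).Connected := Connected.of_subsingleton
  obtain ⟨y, -, hlt⟩ := exists_treedepth_induce_diff_singleton_lt hconn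
  exact (Nat.zero_le _).trans_lt (hlt.trans_le
    (treedepth_induce_mono (Set.singleton_subset_iff.mpr hx)))

lemma min_treedepth_induce_lt_of_disjoint (hA : (G.induce A).Connected) (hB : B ⊆ A) (hC : C ⊆ A)
    (hBC : Disjoint B C) :
    min (G.induce B).treedepth (G.induce C).treedepth < (G.induce A).treedepth := by
  obtain ⟨x, -, hlt⟩ := exists_treedepth_induce_diff_singleton_lt hA
  refine lt_of_le_of_lt ?_ hlt
  by_cases hx : x ∈ B
  · have hxC : x ∉ C := Set.disjoint_left.mp hBC hx
    exact min_le_of_right_le (treedepth_induce_mono (Set.subset_sdiff_singleton hC hxC))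
  · exact min_le_of_left_le (treedepth_induce_mono (Set.subset_sdiff_singleton hB hx))

lemma exists_card_le_treedepth_induce_diff_lt (hA : A.Nonempty) (M : Finset V)
    (hM : ∀ c ∈ A, ∃ u ∈ M, u ∈ componentIn G A c) :
    ∃ X : Finset V, X.card ≤ M.card ∧ (G.induce (A \ X)).treedepth < (G.induce A).treedepth := by
  classical
  have hpick : ∀ u, ∃ x, u ∈ A →
      (G.induce (componentIn G A u \ {x})).treedepth ≤ (G.induce A).treedepth - 1 := by
    intro u
    by_cases hu : u ∈ A
    · obtain ⟨x, -, hx⟩ :=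
        exists_treedepth_induce_diff_singleton_lt (induce_componentIn_connected (G := G) hu)
      exact ⟨x, fun _ => Nat.le_pred_of_lt (hx.trans_le (treedepth_induce_mono componentIn_subset))⟩
    · exact ⟨u, fun h => absurd h hu⟩
  choose f hf using hpick
  refine ⟨M.image f, Finset.card_image_le,
    lt_of_le_of_lt ?_ (Nat.pred_lt_of_lt (treedepth_induce_pos hA))⟩
  refine treedepth_induce_le_of_componentIn fun c hc => ?_
  obtain ⟨u, huM, huc⟩ := hM c hc.1
  refine le_trans (treedepth_induce_mono ?_) (hf u (componentIn_subset huc))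
  refine Set.subset_sdiff_singleton ?_ fun hfu => ?_
  · rw [componentIn_eq_of_mem huc]
    exact subset_componentIn (induce_componentIn_connected hc)
      (componentIn_subset.trans Set.sdiff_subset) (mem_componentIn_self hc)
  · exact (componentIn_subset hfu).2 (Finset.mem_coe.mpr (Finset.mem_image_of_mem f huM))

end Treedepth

section EdgeSplit

variable {V : Type*} {S : SimpleGraph V} {A A₁ A₂ C : Set V} {u w x y z : V}

/-- Removing the edge `uw` from the forest `S` splits the connected set `A` into the connected sets
`A₁` and `A₂`, which contain `u` and `w` respectively. -/
structure IsEdgeSplit (S : SimpleGraph V) (A A₁ A₂ : Set V) (u w : V) : Prop where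
  left_mem : u ∈ A₁
  right_mem : w ∈ A₂
  adj : S.Adj u w
  connected_left : (S.induce A₁).Connected
  connected_right : (S.induce A₂).Connected
  union_eq : A₁ ∪ A₂ = A
  disjoint : Disjoint A₁ A₂
  eq_of_adj : ∀ x ∈ A₁, ∀ y ∈ A₂, S.Adj x y → x = u ∧ y = w

namespace IsEdgeSplit

lemma symm (h : IsEdgeSplit S A A₁ A₂ u w) : IsEdgeSplit S A A₂ A₁ w u where
  left_mem := h.right_mem
  right_mem := h.left_mem
  adj := h.adj.symm
  connected_left := h.connected_right
  connected_right := h.connected_left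
  union_eq := Set.union_comm A₂ A₁ ▸ h.union_eq
  disjoint := h.disjoint.symm
  eq_of_adj x hx y hy hxy := (h.eq_of_adj y hy x hx hxy.symm).symm

lemma left_subset (h : IsEdgeSplit S A A₁ A₂ u w) : A₁ ⊆ A :=
  h.union_eq ▸ Set.subset_union_left

lemma right_subset (h : IsEdgeSplit S A A₁ A₂ u w) : A₂ ⊆ A :=
  h.symm.left_subset

lemma notMem_right (h : IsEdgeSplit S A A₁ A₂ u w) (hx : x ∈ A₁) : x ∉ A₂ :=
  Set.disjoint_left.mp h.disjoint hx

lemma mem_right_of_notMem (h : IsEdgeSplit S A A₁ A₂ u w) (hx : x ∈ A) (hx₁ : x ∉ A₁) : x ∈ A₂ :=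
  (h.union_eq ▸ hx : x ∈ A₁ ∪ A₂).resolve_left hx₁

lemma subset_right (h : IsEdgeSplit S A A₁ A₂ u w) (hC : (S.induce C).Connected) (hCA : C ⊆ A)
    (hu : u ∉ C) (hy : y ∈ C) (hy₂ : y ∈ A₂) : C ⊆ A₂ := by
  refine subset_of_induce_connected hC hy hy₂ fun a ⟨_, ha⟩ b hb hab => ?_
  refine h.mem_right_of_notMem (hCA hb) fun hb₁ => hu ?_
  exact (h.eq_of_adj b hb₁ a ha hab.symm).1 ▸ hb

lemma exists_add_eq {M : Multiset V} (h : IsEdgeSplit S A A₁ A₂ u w)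
    (hM : ∀ x ∈ M, x ∈ A) :
    ∃ M₁ M₂, M₁ + M₂ = M ∧ (∀ x ∈ M₁, x ∈ A₁) ∧ ∀ x ∈ M₂, x ∈ A₂ := by
  classical
  exact ⟨M.filter (· ∈ A₁), M.filter (· ∉ A₁), Multiset.filter_add_not _ M, by simp,
    by simpa using fun x hx => h.mem_right_of_notMem (hM x hx)⟩

end IsEdgeSplit

lemma exists_isEdgeSplit (hS : S.IsAcyclic) (hA : (S.induce A).Connected) (hu : u ∈ A)
    (hw : w ∈ A) (huw : S.Adj u w) : ∃ A₁ A₂, IsEdgeSplit S A A₁ A₂ u w := by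
  let S' := S.deleteEdges {s(u, w)}
  have hadj : ∀ {a b}, S.Adj a b → s(a, b) ≠ s(u, w) → S'.Adj a b := fun hab hne =>
    deleteEdges_adj.mpr ⟨hab, hne⟩
  have hconn : ∀ {x}, x ∈ A → (S.induce (componentIn S' A x)).Connected := fun hx =>
    induce_connected_mono_graph (deleteEdges_le _) (induce_componentIn_connected hx)
  have hdisj : Disjoint (componentIn S' A u) (componentIn S' A w) := by
    refine Set.disjoint_left.mpr fun y hyu hyw => ?_
    have hwu : w ∈ componentIn S' A u :=
      componentIn_eq_of_mem hyu ▸ componentIn_eq_of_mem hyw ▸ mem_componentIn_self hw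
    obtain ⟨C, -, hC, huC, hwC⟩ := hwu
    have hreach : S'.Reachable u w :=
      (hC.preconnected ⟨u, huC⟩ ⟨w, hwC⟩).map (Embedding.induce C).toHom
    exact isBridge_iff.mp (isAcyclic_iff_forall_adj_isBridge.mp hS huw) hreach
  refine ⟨componentIn S' A u, componentIn S' A w, mem_componentIn_self hu, mem_componentIn_self hw,
    huw, hconn hu, hconn hw, ?_, hdisj, fun x hx y hy hxy => ?_⟩
  · refine (Set.union_subset componentIn_subset componentIn_subset).antisymm ?_
    refine subset_of_induce_connected hA hu (Or.inl (mem_componentIn_self hu)) ?_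
    rintro a ⟨-, ha⟩ b hb hab
    by_cases he : s(a, b) = s(u, w)
    · rcases Sym2.eq_iff.mp he with ⟨-, rfl⟩ | ⟨-, rfl⟩
      exacts [Or.inr (mem_componentIn_self hw), Or.inl (mem_componentIn_self hu)]
    · exact ha.imp (fun h => mem_componentIn_of_adj h hb (hadj hab he))
        fun h => mem_componentIn_of_adj h hb (hadj hab he)
  · have he : s(x, y) = s(u, w) := by
      by_contra he
      exact Set.disjoint_left.mp hdisj
        (mem_componentIn_of_adj hx (componentIn_subset hy) (hadj hxy he)) hy
    rcases Sym2.eq_iff.mp he with h | ⟨rfl, -⟩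
    · exact h
    · exact absurd (mem_componentIn_self hw) (Set.disjoint_left.mp hdisj hx)

lemma eq_of_adj_of_isAcyclic (hS : S.IsAcyclic) (hC : (S.induce C).Connected) (hx : x ∉ C)
    (hy : y ∈ C) (hz : z ∈ C) (hxy : S.Adj x y) (hxz : S.Adj x z) : y = z := by
  obtain ⟨A₁, A₂, h⟩ := exists_isEdgeSplit hS (induce_connected_insert hC hy hxy.symm)
    (Set.mem_insert x C) (Set.mem_insert_of_mem x hy) hxy
  have hC₂ : C ⊆ A₂ := h.subset_right hC (Set.subset_insert x C) hx hy h.right_mem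
  exact (h.eq_of_adj x h.left_mem z (hC₂ hz) hxz).2.symm

lemma exists_isEdgeSplit_subset_right (hS : S.IsAcyclic) (hA : (S.induce A).Connected)
    (hw : w ∈ A) (hC : (S.induce C).Connected) (hCA : C ⊆ A \ {w}) :
    ∃ z A₁ A₂, IsEdgeSplit S A A₁ A₂ w z ∧ C ⊆ A₂ := by
  obtain ⟨c, hc⟩ := nonempty_of_induce_connected hC
  have hK := induce_componentIn_connected (G := S) (hCA hc)
  have hwK : w ∉ componentIn S (A \ {w}) c := fun h => (componentIn_subset h).2 rfl
  obtain ⟨a, ⟨haA, haK⟩, b, ⟨hbA, hbK⟩, hab⟩ := exists_adj_of_induce_connected hA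
    ⟨c, (hCA hc).1, mem_componentIn_self (hCA hc)⟩ fun h => hwK (h hw)
  have hbw : b = w := by
    by_contra hne
    exact hbK (mem_componentIn_of_adj haK ⟨hbA, hne⟩ hab)
  subst hbw
  obtain ⟨A₁, A₂, h⟩ := exists_isEdgeSplit hS hA hw haA hab.symm
  exact ⟨a, A₁, A₂, h, (subset_componentIn hC hCA hc).trans
    (h.subset_right hK (componentIn_subset.trans Set.sdiff_subset) hwK haK h.right_mem)⟩

-- Orient each vertex `w` towards a large part of `A \ {w}`, and follow the arrows as long as the
-- part shrinks: some edge is eventually oriented both ways.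
lemma exists_isEdgeSplit_of_forall_exists [Finite V] {P : Set V → Prop}
    (hP : ∀ ⦃B C⦄, B ⊆ C → P B → P C) (hS : S.IsAcyclic) (hA : (S.induce A).Connected)
    (h : ∀ w ∈ A, ∃ C ⊆ A \ {w}, (S.induce C).Connected ∧ P C) :
    ∃ A₁ A₂ u w, IsEdgeSplit S A A₁ A₂ u w ∧ P A₁ ∧ P A₂ := by
  have hsplit : ∀ w ∈ A, ∃ z A₁ A₂, IsEdgeSplit S A A₁ A₂ w z ∧ P A₂ := fun w hw => by
    obtain ⟨C, hCA, hC, hPC⟩ := h w hw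
    obtain ⟨z, A₁, A₂, hs, hCA₂⟩ := exists_isEdgeSplit_subset_right hS hA hw hC hCA
    exact ⟨z, A₁, A₂, hs, hP hCA₂ hPC⟩
  obtain ⟨w₀, hw₀⟩ := nonempty_of_induce_connected hA
  obtain ⟨z₀, B₁, B₂, hs₀, hP₀⟩ := hsplit w₀ hw₀
  obtain ⟨A₂, ⟨w, z, A₁, hs, hPA₂⟩, hmin⟩ := Set.exists_min_image
    {A₂ | ∃ w z A₁, IsEdgeSplit S A A₁ A₂ w z ∧ P A₂} Set.ncard (Set.toFinite _)
    ⟨B₂, w₀, z₀, B₁, hs₀, hP₀⟩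
  obtain ⟨z', B₁, B₂, hs', hPB₂⟩ := hsplit z (hs.right_subset hs.right_mem)
  have hzB₂ : z ∉ B₂ := hs'.notMem_right hs'.left_mem
  by_cases hz' : z' = w
  · subst hz'
    exact ⟨A₁, A₂, z', z, hs, hP (hs.symm.subset_right hs'.connected_right hs'.right_subset hzB₂
      hs'.right_mem hs.left_mem) hPB₂, hPA₂⟩
  · have hwB₂ : w ∉ B₂ := fun hw =>
      hz' (hs'.eq_of_adj z hs'.left_mem w hw hs.adj.symm).2.symm
    have hz'A₂ : z' ∈ A₂ := hs.mem_right_of_notMem (hs'.right_subset hs'.right_mem)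
      fun hz'₁ => hz' (hs.eq_of_adj z' hz'₁ z hs.right_mem hs'.adj.symm).1
    have hsub : B₂ ⊆ A₂ :=
      hs.subset_right hs'.connected_right hs'.right_subset hwB₂ hs'.right_mem hz'A₂
    exact absurd (Set.ncard_lt_ncard ⟨hsub, fun h => hzB₂ (h hs.right_mem)⟩)
      (hmin B₂ ⟨z, z', B₁, hs', hPB₂⟩).not_gt

end EdgeSplit

lemma exists_isEdgeSplit_lt_treedepth {V : Type u} [Finite V] {S : SimpleGraph V} {A : Set V}
    {n : ℕ} (hS : S.IsAcyclic) (hA : (S.induce A).Connected)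
    (hn : n + 1 < (S.induce A).treedepth) :
    ∃ A₁ A₂ u w, IsEdgeSplit S A A₁ A₂ u w ∧
      n < (S.induce A₁).treedepth ∧ n < (S.induce A₂).treedepth := by
  refine exists_isEdgeSplit_of_forall_exists
    (P := fun B => n < (S.induce B).treedepth)
    (fun _ _ hBC h => h.trans_le (treedepth_induce_mono hBC)) hS hA fun w _ => ?_
  have hlt : n < (S.induce (A \ {w})).treedepth :=
    Nat.lt_of_add_lt_add_right (hn.trans_le (treedepth_induce_le_diff_singleton_add_one w))
  contrapose! hlt
  exact treedepth_induce_le_of_componentIn fun x hx =>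
    hlt _ componentIn_subset (induce_componentIn_connected hx)

section Subcubic

variable {V : Type u} [DecidableEq V] {S : SimpleGraph V} {A A₁ A₂ X₁ X₂ : Set V}
  {M M₁ M₂ : Multiset V} {u w x : V}

lemma exists_connected_ncard_neighborSet_add_count_le [Finite V] (hS : S.IsAcyclic)
    (hA : (S.induce A).Connected) (M : Multiset V) (hM : ∀ x ∈ M, x ∈ A) :
    ∃ Y ⊆ A, (S.induce Y).Connected ∧ (∀ x ∈ M, x ∈ Y) ∧
      ∀ x ∈ Y, (S.neighborSet x ∩ Y).ncard + M.count x ≤ M.card := by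
  obtain ⟨Y, ⟨hYA, hY, hMY⟩, hmin⟩ := Set.exists_min_image
    {Y | Y ⊆ A ∧ (S.induce Y).Connected ∧ ∀ x ∈ M, x ∈ Y} Set.ncard (Set.toFinite _)
    ⟨A, subset_rfl, hA, hM⟩
  refine ⟨Y, hYA, hY, hMY, fun x hx => ?_⟩
  have hmark : ∀ z ∈ S.neighborSet x ∩ Y, ∃ m ∈ M, ∃ C, (S.induce C).Connected ∧
      x ∉ C ∧ z ∈ C ∧ m ∈ C := by
    rintro z ⟨hxz, hz⟩
    obtain ⟨Y₁, Y₂, h⟩ := exists_isEdgeSplit hS hY hx hz hxz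
    by_contra! hno
    refine (hmin Y₁ ⟨h.left_subset.trans hYA, h.connected_left, fun m hm => ?_⟩).not_gt
      (Set.ncard_lt_ncard ⟨h.left_subset, fun hsub => ?_⟩)
    · by_contra hm₁
      exact hno m hm Y₂ h.connected_right (h.notMem_right h.left_mem) h.right_mem
        (h.mem_right_of_notMem (hMY m hm) hm₁)
    · exact h.notMem_right (hsub hz) h.right_mem
  choose! m hmM C hC hxC hzC hmC using hmark
  have hinj : Set.InjOn m (S.neighborSet x ∩ Y) := fun z hz z' hz' heq =>
    eq_of_adj_of_isAcyclic hS
      (induce_connected_union (hC z hz) (hC z' hz') ⟨m z, hmC z hz, heq ▸ hmC z' hz'⟩)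
      (fun h => h.elim (hxC z hz) (hxC z' hz')) (Or.inl (hzC z hz)) (Or.inr (hzC z' hz')) hz.1 hz'.1
  have hmaps : ∀ z ∈ S.neighborSet x ∩ Y, m z ∈ (M.filter (x ≠ ·)).toFinset := fun z hz =>
    Multiset.mem_toFinset.mpr
      (Multiset.mem_filter.mpr ⟨hmM z hz, fun h => hxC z hz (h ▸ hmC z hz)⟩)
  calc (S.neighborSet x ∩ Y).ncard + M.count x
      ≤ (M.filter (x ≠ ·)).card + (M.filter (x = ·)).card := by
        rw [← Multiset.count_eq_card_filter_eq]
        refine Nat.add_le_add_right (le_trans ?_ (Multiset.toFinset_card_le _)) _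
        rw [← Set.ncard_coe_finset]
        exact Set.ncard_le_ncard_of_injOn m hmaps hinj
    _ = M.card := by
        rw [add_comm, ← Multiset.card_add, Multiset.filter_add_not]

/-- `X` is a connected set in the forest `S` that contains the marks `M`, and it keeps maximum
degree at most `3` when one further edge is attached at each mark, with multiplicity. -/
structure IsMarkedSubcubic (S : SimpleGraph V) (M : Multiset V) (X : Set V) : Prop where
  connected : (S.induce X).Connected
  mem : ∀ x ∈ M, x ∈ X
  ncard_add_count_le : ∀ x ∈ X, (S.neighborSet x ∩ X).ncard + M.count x ≤ 3

lemma exists_isMarkedSubcubic [Finite V] (hS : S.IsAcyclic) (hA : (S.induce A).Connected)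
    (hM : ∀ x ∈ M, x ∈ A) (hcard : M.card ≤ 3) : ∃ X ⊆ A, IsMarkedSubcubic S M X := by
  obtain ⟨X, hXA, hX, hMX, hdeg⟩ := exists_connected_ncard_neighborSet_add_count_le hS hA M hM
  exact ⟨X, hXA, hX, hMX, fun x hx => (hdeg x hx).trans hcard⟩

lemma IsEdgeSplit.ncard_neighborSet_union_add_count_le [Finite V]
    (h : IsEdgeSplit S A A₁ A₂ u w) (hX₁ : IsMarkedSubcubic S (u ::ₘ M₁) X₁) (hXA₁ : X₁ ⊆ A₁)
    (hXA₂ : X₂ ⊆ A₂) (hM₂ : ∀ x ∈ M₂, x ∈ X₂) (hx : x ∈ X₁) :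
    (S.neighborSet x ∩ (X₁ ∪ X₂)).ncard + (M₁ + M₂).count x ≤ 3 := by
  have hM₂x : M₂.count x = 0 :=
    Multiset.count_eq_zero.mpr fun hxM => h.notMem_right (hXA₁ hx) (hXA₂ (hM₂ x hxM))
  have hcross : (S.neighborSet x ∩ X₂).ncard ≤ if x = u then 1 else 0 := by
    split_ifs with hxu
    · exact (Set.ncard_le_ncard fun y hy => (h.eq_of_adj x (hXA₁ hx) y (hXA₂ hy.2) hy.1).2).trans
        (Set.ncard_singleton w).le
    · refine ((Set.ncard_eq_zero).mpr (Set.eq_empty_of_forall_notMem fun y hy => hxu ?_)).le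
      exact (h.eq_of_adj x (hXA₁ hx) y (hXA₂ hy.2) hy.1).1
  have hdeg := hX₁.ncard_add_count_le x hx
  have hunion := Set.ncard_union_le (S.neighborSet x ∩ X₁) (S.neighborSet x ∩ X₂)
  rw [Multiset.count_cons] at hdeg
  rw [Set.inter_union_distrib_left, Multiset.count_add]
  omega

lemma IsEdgeSplit.isMarkedSubcubic_union [Finite V] (h : IsEdgeSplit S A A₁ A₂ u w)
    (hX₁ : IsMarkedSubcubic S (u ::ₘ M₁) X₁) (hXA₁ : X₁ ⊆ A₁)
    (hX₂ : IsMarkedSubcubic S (w ::ₘ M₂) X₂) (hXA₂ : X₂ ⊆ A₂) :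
    IsMarkedSubcubic S (M₁ + M₂) (X₁ ∪ X₂) := by
  have hM₁ : ∀ x ∈ M₁, x ∈ X₁ := fun x hx => hX₁.mem x (Multiset.mem_cons_of_mem hx)
  have hM₂ : ∀ x ∈ M₂, x ∈ X₂ := fun x hx => hX₂.mem x (Multiset.mem_cons_of_mem hx)
  refine ⟨induce_connected_union_of_adj hX₁.connected hX₂.connected
    (hX₁.mem u (Multiset.mem_cons_self u M₁)) (hX₂.mem w (Multiset.mem_cons_self w M₂)) h.adj,
    fun x hx => (Multiset.mem_add.mp hx).imp (hM₁ x) (hM₂ x), fun x hx => ?_⟩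
  rcases hx with hx | hx
  · exact h.ncard_neighborSet_union_add_count_le hX₁ hXA₁ hXA₂ hM₂ hx
  · rw [Set.union_comm, add_comm M₁]
    exact h.symm.ncard_neighborSet_union_add_count_le hX₂ hXA₂ hXA₁ hM₁ hx

lemma IsEdgeSplit.exists_isMarkedSubcubic_of_right [Finite V] (hS : S.IsAcyclic)
    (h : IsEdgeSplit S A A₁ A₂ u w) (hM : ∀ x ∈ M, x ∈ A₁) (hcard : M.card ≤ 2)
    (hX₂ : IsMarkedSubcubic S {w} X₂) (hXA₂ : X₂ ⊆ A₂) :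
    ∃ X ⊆ A, IsMarkedSubcubic S M X ∧ X₂ ⊆ X := by
  obtain ⟨X₁, hXA₁, hX₁⟩ := exists_isMarkedSubcubic (M := u ::ₘ M) hS h.connected_left
    (Multiset.forall_mem_cons.mpr ⟨h.left_mem, hM⟩)
    ((Multiset.card_cons u M).trans_le (Nat.succ_le_succ hcard))
  exact ⟨X₁ ∪ X₂, Set.union_subset (hXA₁.trans h.left_subset) (hXA₂.trans h.right_subset),
    add_zero M ▸ h.isMarkedSubcubic_union hX₁ hXA₁ hX₂ hXA₂, Set.subset_union_right⟩

-- An edge split hands its marks over to the two parts, each of which receives an end of the removed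
-- edge as a new mark. If a part would get three marks, then the other one gets a single mark, and
-- the large treedepth is sought there.
lemma exists_isMarkedSubcubic_lt_treedepth [Finite V] (hS : S.IsAcyclic) (k : ℕ)
    (hA : (S.induce A).Connected) (hM : ∀ x ∈ M, x ∈ A) (hcard : M.card ≤ 2)
    (htd : 2 * k + M.card ≤ (S.induce A).treedepth) :
    ∃ X ⊆ A, IsMarkedSubcubic S M X ∧ k < (S.induce X).treedepth := by
  induction hm : 2 * k + M.card using Nat.strong_induction_on generalizing k A M with
  | _ m ih =>
    subst hm
    obtain _ | k := k
    · obtain ⟨X, hXA, hX⟩ := exists_isMarkedSubcubic hS hA hM (hcard.trans (Nat.le_succ 2))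
      exact ⟨X, hXA, hX, treedepth_induce_pos (nonempty_of_induce_connected hX.connected)⟩
    obtain ⟨A₁, A₂, u, w, h, htd₁, htd₂⟩ :=
      exists_isEdgeSplit_lt_treedepth (n := 2 * k + M.card) hS hA (by omega)
    have hone_side : ∀ {A₁ A₂ u w}, IsEdgeSplit S A A₁ A₂ u w → (∀ x ∈ M, x ∈ A₁) → M.card = 2 →
        2 * k + M.card < (S.induce A₂).treedepth →
        ∃ X ⊆ A, IsMarkedSubcubic S M X ∧ k + 1 < (S.induce X).treedepth := by
      intro A₁ A₂ u w h hM₁ hcard htd₂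
      obtain ⟨X₂, hXA₂, hX₂, hlt⟩ := ih _ (by simp; omega) (M := {w}) (k + 1) h.connected_right
        (by simpa using h.right_mem) (by simp) (by simp; omega) rfl
      obtain ⟨X, hXA, hX, hX₂X⟩ := h.exists_isMarkedSubcubic_of_right hS hM₁ hcard.le hX₂ hXA₂
      exact ⟨X, hXA, hX, hlt.trans_le (treedepth_induce_mono hX₂X)⟩
    obtain ⟨M₁, M₂, rfl, hM₁, hM₂⟩ := h.exists_add_eq hM
    rw [Multiset.card_add] at hcard htd₁ htd₂
    by_cases hM₁two : M₁.card = 2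
    · obtain rfl : M₂ = 0 := Multiset.card_eq_zero.mp (by omega)
      exact hone_side h (by simpa using hM₁) (by simpa using hM₁two) (by simpa using htd₂)
    by_cases hM₂two : M₂.card = 2
    · obtain rfl : M₁ = 0 := Multiset.card_eq_zero.mp (by omega)
      exact hone_side h.symm (by simpa using hM₂) (by simpa using hM₂two) (by simpa using htd₁)
    obtain ⟨X₁, hXA₁, hX₁, hlt₁⟩ := ih _ (by simp; omega) (M := u ::ₘ M₁) k h.connected_left
      (Multiset.forall_mem_cons.mpr ⟨h.left_mem, hM₁⟩) (by simp; omega) (by simp; omega) rfl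
    obtain ⟨X₂, hXA₂, hX₂, hlt₂⟩ := ih _ (by simp; omega) (M := w ::ₘ M₂) k h.connected_right
      (Multiset.forall_mem_cons.mpr ⟨h.right_mem, hM₂⟩) (by simp; omega) (by simp; omega) rfl
    have hX := h.isMarkedSubcubic_union hX₁ hXA₁ hX₂ hXA₂
    have hmin := min_treedepth_induce_lt_of_disjoint hX.connected Set.subset_union_left
      Set.subset_union_right (h.disjoint.mono hXA₁ hXA₂)
    exact ⟨X₁ ∪ X₂, Set.union_subset (hXA₁.trans h.left_subset) (hXA₂.trans h.right_subset), hX,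
      by omega⟩

end Subcubic

lemma exists_subcubic_treedepth_le {V : Type u} [Finite V] {S : SimpleGraph V} (hS : S.IsTree) :
    ∃ X : Set V, (S.induce X).Connected ∧ (∀ x ∈ X, (S.neighborSet x ∩ X).ncard ≤ 3) ∧
      S.treedepth ≤ 2 * (S.induce X).treedepth := by
  classical
  obtain ⟨X, -, hX, hlt⟩ := exists_isMarkedSubcubic_lt_treedepth (M := 0) hS.isAcyclic
    (S.treedepth / 2) (induce_univ_connected hS.connected) (by simp) (by simp)
    (by simpa [treedepth_induce_univ] using Nat.mul_div_le S.treedepth 2)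
  exact ⟨X, hX.connected, fun x hx => by simpa using hX.ncard_add_count_le x hx, by omega⟩

section Ancestors

variable {V : Type u} {G : SimpleGraph V} {N : Type v} {D : G.TreeDecomposition N}
  {a b d p x : N} {A C : Set N}

lemma isAncestor_iff_mem_support {q : D.tree.Walk D.root d} (hq : q.IsPath) :
    D.IsAncestor a d ↔ a ∈ q.support := by
  refine ⟨?_, fun h => ⟨q, hq, h⟩⟩
  rintro ⟨q', hq', ha⟩
  rwa [(D.isTree.existsUnique_path D.root d).unique hq hq']

lemma exists_isPath_root (D : G.TreeDecomposition N) (d : N) :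
    ∃ q : D.tree.Walk D.root d, q.IsPath :=
  (D.isTree.existsUnique_path D.root d).exists

lemma isAncestor_refl (a : N) : D.IsAncestor a a := by
  obtain ⟨q, hq⟩ := exists_isPath_root D a
  exact ⟨q, hq, q.end_mem_support⟩

lemma root_isAncestor (a : N) : D.IsAncestor D.root a := by
  obtain ⟨q, hq⟩ := exists_isPath_root D a
  exact ⟨q, hq, q.start_mem_support⟩

lemma induce_ancestors_connected (d : N) : (D.tree.induce {a | D.IsAncestor a d}).Connected := by
  obtain ⟨q, hq⟩ := exists_isPath_root D d
  have hset : {a | D.IsAncestor a d} = {a | a ∈ q.support} :=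
    Set.ext fun _ => isAncestor_iff_mem_support hq
  exact hset ▸ q.connected_induce_support

lemma mem_of_isAncestor_of_root_mem (hC : (D.tree.induce C).Connected) (hr : D.root ∈ C)
    (hd : d ∈ C) (had : D.IsAncestor a d) : a ∈ C := by
  obtain ⟨q, hq⟩ := (hC.preconnected ⟨D.root, hr⟩ ⟨d, hd⟩).exists_isPath
  have hmap : (q.map (Embedding.induce C).toHom).IsPath := hq.map Subtype.val_injective
  have ha : a ∈ (q.map (Embedding.induce C).toHom).support :=
    (isAncestor_iff_mem_support hmap).mp had
  rw [Walk.support_map] at ha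
  obtain ⟨c, -, rfl⟩ := List.mem_map.mp ha
  exact c.2

lemma isAncestor_trans (hab : D.IsAncestor a b) (hbd : D.IsAncestor b d) : D.IsAncestor a d :=
  mem_of_isAncestor_of_root_mem (C := {x | D.IsAncestor x d}) (induce_ancestors_connected d)
    (root_isAncestor d) hbd hab

lemma isAncestor_antisymm (hab : D.IsAncestor a b) (hba : D.IsAncestor b a) : a = b := by
  classical
  obtain ⟨q, hq⟩ := exists_isPath_root D b
  have ha := (isAncestor_iff_mem_support hq).mp hab
  by_contra hne
  exact Walk.endpoint_notMem_support_takeUntil hq ha (Ne.symm hne)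
    ((isAncestor_iff_mem_support (hq.takeUntil ha)).mp hba)

lemma isAncestor_getVert {q : D.tree.Walk D.root d} (hq : q.IsPath) {i j : ℕ} (hij : i ≤ j) :
    D.IsAncestor (q.getVert i) (q.getVert j) := by
  refine ⟨q.take j, hq.take j, ?_⟩
  have hmem := (q.take j).getVert_mem_support i
  rwa [Walk.take_getVert, min_eq_right hij] at hmem

lemma isAncestor_total (had : D.IsAncestor a d) (hbd : D.IsAncestor b d) :
    D.IsAncestor a b ∨ D.IsAncestor b a := by
  obtain ⟨q, hq⟩ := exists_isPath_root D d
  rw [isAncestor_iff_mem_support hq, Walk.mem_support_iff_exists_getVert] at had hbd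
  obtain ⟨i, rfl, -⟩ := had
  obtain ⟨j, rfl, -⟩ := hbd
  exact (le_total i j).imp (isAncestor_getVert hq) (isAncestor_getVert hq)

/-- The ancestor relation of the rooted tree of `D`, as a rooted forest. -/
def ancestorForest (D : G.TreeDecomposition N) : RootedForest N where
  anc := D.IsAncestor
  anc_refl := isAncestor_refl
  anc_antisymm _ _ := isAncestor_antisymm
  anc_trans _ _ _ := isAncestor_trans
  anc_chain _ _ _ := isAncestor_total

lemma isAncestor_or_of_tree_adj (hab : D.tree.Adj a b) : D.IsAncestor a b ∨ D.IsAncestor b a := by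
  obtain ⟨q, hq⟩ := exists_isPath_root D a
  by_cases hb : b ∈ q.support
  · exact Or.inr ⟨q, hq, hb⟩
  · exact Or.inl ⟨q.concat hab, hq.concat hb hab, by simp [Walk.support_concat]⟩

lemma exists_forall_isAncestor [Finite N] (hA : (D.tree.induce A).Connected) :
    ∃ a ∈ A, ∀ x ∈ A, D.IsAncestor a x :=
  exists_forall_anc (ancestorForest D) hA fun _ _ _ _ => isAncestor_or_of_tree_adj

lemma mem_of_isAncestor_of_isAncestor (hC : (D.tree.induce C).Connected) (ha : a ∈ C)
    (hd : d ∈ C) (hab : D.IsAncestor a b) (hbd : D.IsAncestor b d) : b ∈ C := by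
  have hconn := induce_connected_union (induce_ancestors_connected (D := D) a) hC
    ⟨a, isAncestor_refl a, ha⟩
  rcases mem_of_isAncestor_of_root_mem hconn (Or.inl (root_isAncestor a)) (Or.inr hd) hbd
    with hba | hb
  · rwa [isAncestor_antisymm hba hab]
  · exact hb

lemma isAncestor_of_isChild (hb : D.IsChild b p) (hx : D.IsAncestor x b) (hne : x ≠ b) :
    D.IsAncestor x p :=
  (mem_of_isAncestor_of_root_mem
    (induce_connected_insert (induce_ancestors_connected p) (isAncestor_refl p) hb.1)
    (Or.inr (root_isAncestor p)) (Set.mem_insert b _) hx).resolve_left hne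

lemma ne_of_isChild (h : D.IsChild b a) : a ≠ b :=
  h.1.ne

lemma ne_root_of_isChild (h : D.IsChild b a) : b ≠ D.root := by
  rintro rfl
  exact ne_of_isChild h (isAncestor_antisymm h.2 (root_isAncestor a))

lemma eq_of_isChild_of_isChild (ha : D.IsChild b a) (hp : D.IsChild b p) : a = p :=
  isAncestor_antisymm (isAncestor_of_isChild hp ha.2 (ne_of_isChild ha))
    (isAncestor_of_isChild ha hp.2 (ne_of_isChild hp))

lemma isAncestor_iff_reflTransGen_isChild :
    D.IsAncestor a d ↔ Relation.ReflTransGen (fun x y => D.IsChild y x) a d := by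
  constructor
  · rintro ⟨q, hq, ha⟩
    obtain ⟨i, rfl, hi⟩ := Walk.mem_support_iff_exists_getVert.mp ha
    have hdown : ∀ j, i ≤ j → j ≤ q.length →
        Relation.ReflTransGen (fun x y => D.IsChild y x) (q.getVert i) (q.getVert j) := by
      intro j hij
      induction j, hij using Nat.le_induction with
      | base => exact fun _ => .refl
      | succ j _ ih =>
        exact fun hj => (ih (Nat.le_of_succ_le hj)).tail
          ⟨q.adj_getVert_succ hj, isAncestor_getVert hq (Nat.le_succ j)⟩
    simpa only [Walk.getVert_length] using hdown q.length hi le_rfl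
  · intro h
    induction h with
    | refl => exact isAncestor_refl a
    | tail _ hc ih => exact isAncestor_trans ih hc.2

lemma exists_isChild (hb : b ≠ D.root) : ∃ a, D.IsChild b a := by
  rcases (isAncestor_iff_reflTransGen_isChild.mp (root_isAncestor b)).cases_tail
    with h | ⟨a, -, ha⟩
  exacts [absurd h hb, ⟨a, ha⟩]

lemma exists_isChild_of_mem_of_notMem (had : D.IsAncestor a d) (ha : a ∈ A) (hd : d ∉ A) :
    ∃ p ∈ A, ∃ b ∉ A, D.IsChild b p ∧ D.IsAncestor a p ∧ D.IsAncestor b d := by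
  have hchain := isAncestor_iff_reflTransGen_isChild.mp had
  clear had
  induction hchain using Relation.ReflTransGen.head_induction_on with
  | refl => exact absurd ha hd
  | @head a c hc hcd ih =>
    by_cases hcA : c ∈ A
    · obtain ⟨p, hp, b, hb, hbp, hcp, hbd⟩ := ih hcA
      exact ⟨p, hp, b, hb, hbp, isAncestor_trans hc.2 hcp, hbd⟩
    · exact ⟨a, ha, c, hcA, hc, isAncestor_refl a, isAncestor_iff_reflTransGen_isChild.mpr hcd⟩

end Ancestors

section SpanningTree

variable {V : Type u} [Finite V] {G S : SimpleGraph V}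

lemma isTree_fromEdgeSet_image (e : V → Sym2 V) (r : V)
    (h : (fromEdgeSet (e '' {r}ᶜ)).Connected) : (fromEdgeSet (e '' {r}ᶜ)).IsTree := by
  refine isTree_iff_connected_and_card.mpr ⟨h, h.card_vert_le_card_edgeSet_add_one.antisymm' ?_⟩
  calc (fromEdgeSet (e '' {r}ᶜ)).edgeSet.ncard + 1
      ≤ ({r}ᶜ : Set V).ncard + 1 := by
        rw [edgeSet_fromEdgeSet]
        exact Nat.add_le_add_right
          ((Set.ncard_le_ncard Set.sdiff_subset).trans Set.ncard_image_le) 1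
    _ = Nat.card V := by
        rw [← Set.ncard_add_ncard_compl {r}, Set.ncard_singleton, add_comm]

lemma induce_descendants_connected {D : G.TreeDecomposition V}
    (hS : ∀ b a, D.IsChild b a → ∃ z, D.IsAncestor b z ∧ S.Adj a z) (v : V) :
    (S.induce {x | D.IsAncestor v x}).Connected := by
  induction hn : {x | D.IsAncestor v x}.ncard using Nat.strong_induction_on generalizing v with
  | _ n ih =>
  refine induce_connected_of_patches v (isAncestor_refl v) fun {x} hx => ?_
  by_cases hxv : x = v
  · subst hxv
    exact ⟨{x}, Set.singleton_subset_iff.mpr hx, rfl, rfl, Reachable.refl _⟩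
  obtain ⟨v, rfl, c, -, hc, -, hcx⟩ :=
    exists_isChild_of_mem_of_notMem (A := {v}) hx rfl hxv
  have hlt : {x | D.IsAncestor c x}.ncard < {x | D.IsAncestor v x}.ncard :=
    Set.ncard_lt_ncard ⟨fun y hy => isAncestor_trans hc.2 hy,
      fun h => ne_of_isChild hc (isAncestor_antisymm hc.2 (h (isAncestor_refl v)))⟩
  obtain ⟨z, hcz, hvz⟩ := hS c v hc
  have hconn := induce_connected_insert (ih _ (hn ▸ hlt) c rfl) hcz hvz.symm
  exact ⟨insert v {x | D.IsAncestor c x},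
    Set.insert_subset (isAncestor_refl v) fun y hy => isAncestor_trans hc.2 hy,
    Or.inl rfl, Or.inr hcx, hconn.preconnected _ _⟩

lemma exists_isTree_le_of_isGreedy {D : G.TreeDecomposition V} (hD : D.IsGreedy) :
    ∃ S ≤ G, S.IsTree ∧ ∀ v, (S.induce {x | D.IsAncestor v x}).Connected := by
  have hparent : ∀ b, ∃ a z, b ≠ D.root → D.IsChild b a ∧ D.IsAncestor b z ∧ G.Adj a z := by
    intro b
    by_cases hb : b = D.root
    · exact ⟨b, b, fun h => absurd hb h⟩
    · obtain ⟨a, ha⟩ := exists_isChild hb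
      obtain ⟨z, hz⟩ := hD.exists_adj_of_isChild a b ha
      exact ⟨a, z, fun _ => ⟨ha, hz⟩⟩
  choose a z haz using hparent
  set S := fromEdgeSet ((fun b => s(a b, z b)) '' {D.root}ᶜ)
  have hconn : ∀ v, (S.induce {x | D.IsAncestor v x}).Connected := by
    refine induce_descendants_connected fun b p hp => ?_
    have hb := ne_root_of_isChild hp
    obtain ⟨ha, hbz, hadj⟩ := haz b hb
    rw [eq_of_isChild_of_isChild hp ha]
    exact ⟨z b, hbz, (fromEdgeSet_adj _).mpr ⟨⟨b, hb, rfl⟩, hadj.ne⟩⟩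
  have huniv : {x | D.IsAncestor D.root x} = Set.univ := Set.eq_univ_of_forall root_isAncestor
  have hS_conn : S.Connected :=
    (Iso.connected_iff (induceUnivIso S)).mp (huniv ▸ hconn D.root)
  refine ⟨S, fun x y hxy => ?_, isTree_fromEdgeSet_image _ _ hS_conn, hconn⟩
  obtain ⟨⟨b, hb, he⟩, -⟩ := (fromEdgeSet_adj _).mp hxy
  exact (mem_edgeSet G).mp (he ▸ (mem_edgeSet G).mpr (haz b hb).2.2)

end SpanningTree

section Separators

variable {V : Type u} {T : SimpleGraph V} {A C X : Set V} {x y : V} {l n : ℕ}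

/-- The inner vertex boundary of `C`: the vertices of `C` with a neighbour outside `C`. -/
def innerBoundary (T : SimpleGraph V) (C : Set V) : Set V :=
  {p | p ∈ C ∧ ∃ q, q ∉ C ∧ T.Adj p q}

/-- The vertices of `C` still to be separated from each other: those of `X`, and those through which
`C` is attached to the rest of the graph. -/
def terminals (T : SimpleGraph V) (X C : Set V) : Set V :=
  X ∩ C ∪ innerBoundary T C

lemma innerBoundary_univ : innerBoundary T Set.univ = ∅ :=
  Set.eq_empty_of_forall_notMem fun _ ⟨_, _, hq, _⟩ => hq (Set.mem_univ _)

variable [Finite V]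

lemma ncard_terminals_componentIn_le (hT : T.IsAcyclic) (hy : y ∈ C \ {x}) :
    (terminals T X (componentIn T (C \ {x}) y)).ncard ≤
      (terminals T X C ∩ componentIn T (C \ {x}) y).ncard + 1 := by
  set K := componentIn T (C \ {x}) y
  have hKC : K ⊆ C \ {x} := componentIn_subset
  have hneighbour : {z ∈ K | T.Adj x z}.ncard ≤ 1 :=
    (Set.ncard_le_one_iff (Set.toFinite _)).mpr fun hz hz' => eq_of_adj_of_isAcyclic hT
      (induce_componentIn_connected hy) (fun h => (hKC h).2 rfl) hz.1 hz'.1 hz.2 hz'.2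
  have hsub : terminals T X K ⊆ terminals T X C ∩ K ∪ {z ∈ K | T.Adj x z} := by
    rintro z (⟨hzX, hzK⟩ | ⟨hzK, q, hqK, hzq⟩)
    · exact Or.inl ⟨Or.inl ⟨hzX, (hKC hzK).1⟩, hzK⟩
    by_cases hqx : q = x
    · exact Or.inr ⟨hzK, hqx ▸ hzq.symm⟩
    · refine Or.inl ⟨Or.inr ⟨(hKC hzK).1, q, fun hqC => hqK ?_, hzq⟩, hzK⟩
      exact mem_componentIn_of_adj hzK ⟨hqC, hqx⟩ hzq
  calc _ ≤ _ := Set.ncard_le_ncard hsub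
    _ ≤ _ := Set.ncard_union_le _ _
    _ ≤ _ := Nat.add_le_add_left hneighbour _

lemma treedepth_induce_le_of_ncard_terminals_le_three (hT : T.IsAcyclic)
    (h : ∀ K ⊆ A, (T.induce K).Connected → Disjoint X K → (innerBoundary T K).ncard ≤ 3 →
      (T.induce K).treedepth ≤ n)
    (hCA : C ⊆ A) (hC : (T.induce C).Connected) (hterm : (terminals T X C).ncard ≤ 3) :
    (T.induce C).treedepth ≤ n + (X ∩ C).ncard := by
  induction hi : (X ∩ C).ncard using Nat.strong_induction_on generalizing C with
  | _ i ih =>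
  subst hi
  rcases (X ∩ C).eq_empty_or_nonempty with he | ⟨x, hxX, hxC⟩
  · rw [terminals, he, Set.empty_union] at hterm
    exact (h C hCA hC (Set.disjoint_iff_inter_eq_empty.mpr he) hterm).trans (Nat.le_add_right _ _)
  have hcomp : (T.induce (C \ {x})).treedepth ≤ n + ((X ∩ C).ncard - 1) := by
    refine treedepth_induce_le_of_componentIn fun y hy => ?_
    set K := componentIn T (C \ {x}) y
    have hKC : K ⊆ C \ {x} := componentIn_subset
    have hxK : x ∉ K := fun hx => (hKC hx).2 rfl
    have hX : (X ∩ K).ncard < (X ∩ C).ncard :=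
      Set.ncard_lt_ncard ⟨Set.inter_subset_inter_right _ (hKC.trans Set.sdiff_subset),
        fun hsub => hxK (hsub ⟨hxX, hxC⟩).2⟩
    have hdrop : (terminals T X C ∩ K).ncard < (terminals T X C).ncard :=
      Set.ncard_lt_ncard ⟨Set.inter_subset_left, fun hsub => hxK (hsub (Or.inl ⟨hxX, hxC⟩)).2⟩
    have hterm' : (terminals T X K).ncard ≤ 3 :=
      (ncard_terminals_componentIn_le hT hy).trans (hdrop.trans_le hterm)
    have hK := ih _ hX ((hKC.trans Set.sdiff_subset).trans hCA)
      (induce_componentIn_connected hy) hterm' rfl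
    exact hK.trans (Nat.add_le_add_left (Nat.le_pred_of_lt hX) n)
  have hpos : 0 < (X ∩ C).ncard := (Set.ncard_pos (Set.toFinite _)).mpr ⟨x, hxX, hxC⟩
  have hdel := treedepth_induce_le_diff_singleton_add_one (G := T) (A := C) x
  omega

lemma exists_forall_ncard_inter_lt (hT : T.IsAcyclic) (hC : (T.induce C).Connected) {M : Set V}
    {k : ℕ} (hM : M.ncard < 2 * k) :
    ∃ w ∈ C, ∀ K ⊆ C \ {w}, (T.induce K).Connected → (M ∩ K).ncard < k := by
  by_contra! hheavy
  obtain ⟨A₁, A₂, u, w, hs, h₁, h₂⟩ :=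
    exists_isEdgeSplit_of_forall_exists (P := fun B => k ≤ (M ∩ B).ncard)
      (fun B B' hB hle => hle.trans (Set.ncard_le_ncard (Set.inter_subset_inter_right _ hB)))
      hT hC hheavy
  have hunion := Set.ncard_union_eq
    (hs.disjoint.mono (Set.inter_subset_right (s := M)) (Set.inter_subset_right (s := M)))
  have hle : (M ∩ A₁ ∪ M ∩ A₂).ncard ≤ M.ncard :=
    Set.ncard_le_ncard (Set.union_subset Set.inter_subset_left Set.inter_subset_left)
  omega

lemma treedepth_induce_le_of_ncard_terminals_le (hT : T.IsAcyclic)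
    (h : ∀ K ⊆ A, (T.induce K).Connected → Disjoint X K → (innerBoundary T K).ncard ≤ 3 →
      (T.induce K).treedepth ≤ n)
    (hCA : C ⊆ A) (hC : (T.induce C).Connected) (hterm : (terminals T X C).ncard ≤ 2 ^ l + 2) :
    (T.induce C).treedepth ≤ n + 3 + l := by
  induction l generalizing C with
  | zero =>
    have hX : (X ∩ C).ncard ≤ 3 := (Set.ncard_le_ncard Set.subset_union_left).trans hterm
    exact (treedepth_induce_le_of_ncard_terminals_le_three hT h hCA hC hterm).trans
      (Nat.add_le_add_left hX n)
  | succ l ih =>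
    obtain ⟨w, -, hw⟩ := exists_forall_ncard_inter_lt (k := 2 ^ l + 2) hT hC
      (M := terminals T X C) (by rw [pow_succ] at hterm; omega)
    refine (treedepth_induce_le_diff_singleton_add_one w).trans (Nat.succ_le_succ ?_)
    refine treedepth_induce_le_of_componentIn fun y hy => ?_
    have hK := induce_componentIn_connected (G := T) hy
    refine ih ((componentIn_subset.trans Set.sdiff_subset).trans hCA) hK ?_
    exact (ncard_terminals_componentIn_le hT hy).trans (hw _ componentIn_subset hK)

end Separators

section Greedy

variable {V : Type u} {G S : SimpleGraph V} {D : G.TreeDecomposition V} {A : Set V} {a c t x y : V}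

lemma mem_bag_of_adj (hD : D.IsGreedy) (hxy : G.Adj x y) (hxt : D.IsAncestor x t)
    (hty : D.IsAncestor t y) : x ∈ D.bag t := by
  obtain ⟨s, hxs, hys⟩ := D.exists_bag_of_adj x y hxy
  exact mem_of_isAncestor_of_isAncestor (C := {s | x ∈ D.bag s}) (D.connected_bags x)
    (hD.mem_bag_self x) hxs hxt (isAncestor_trans hty (hD.isAncestor_of_mem_bag y s hys))

lemma mem_componentIn_or_exists_mem_bag (hD : D.IsGreedy) (hSG : S ≤ G)
    (hS : (S.induce {x | D.IsAncestor a x}).Connected) (hA : (D.tree.induce A).Connected)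
    (ha : a ∈ A) (htop : ∀ x ∈ A, D.IsAncestor a x) (hc : c ∈ A) :
    a ∈ componentIn S A c ∨
      ∃ u ∈ componentIn S A c, ∃ p ∈ innerBoundary D.tree A, u ∈ D.bag p := by
  rw [or_iff_not_imp_left]
  intro haK
  obtain ⟨u, ⟨-, huK⟩, w, ⟨haw, hwK⟩, huw⟩ := exists_adj_of_induce_connected hS
    ⟨c, htop c hc, mem_componentIn_self hc⟩ fun hsub => haK (hsub (isAncestor_refl a))
  have huA : u ∈ A := componentIn_subset huK
  have hwA : w ∉ A := fun hwA => hwK (mem_componentIn_of_adj huK hwA huw)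
  obtain ⟨p, hpA, b, hbA, hbp, hap, hbw⟩ := exists_isChild_of_mem_of_notMem haw ha hwA
  have hbu : ¬ D.IsAncestor b u := fun h =>
    hbA (mem_of_isAncestor_of_isAncestor hA ha huA (isAncestor_trans hap hbp.2) h)
  have huw' : D.IsAncestor u w :=
    (hD.isAncestor_or_of_adj u w (hSG huw)).resolve_right fun h => hbu (isAncestor_trans hbw h)
  have hub : D.IsAncestor u b := (isAncestor_total huw' hbw).resolve_right hbu
  have hup : D.IsAncestor u p := isAncestor_of_isChild hbp hub fun h => hbA (h ▸ huA)
  exact ⟨u, huK, p, ⟨hpA, b, hbA, hbp.1⟩,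
    mem_bag_of_adj hD (hSG huw) hup (isAncestor_trans hbp.2 hbw)⟩

variable [Finite V]

lemma exists_card_le_mul_treedepth_induce_diff_lt (hD : D.IsGreedy) (hSG : S ≤ G)
    (hS : ∀ v, (S.induce {x | D.IsAncestor v x}).Connected) {k m : ℕ}
    (hm : ∀ t, (D.bag t).card ≤ m) (hA : (D.tree.induce A).Connected)
    (hbd : (innerBoundary D.tree A).ncard ≤ k) :
    ∃ X : Finset V, X.card ≤ k * m + 1 ∧
      (S.induce (A \ X)).treedepth < (S.induce A).treedepth := by
  classical
  obtain ⟨a, ha, htop⟩ := exists_forall_isAncestor hA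
  have hfin : (innerBoundary D.tree A).Finite := Set.toFinite _
  have hcard : (insert a (hfin.toFinset.biUnion D.bag)).card ≤ k * m + 1 := by
    refine (Finset.card_insert_le _ _).trans (Nat.succ_le_succ ?_)
    refine (Finset.card_biUnion_le_card_mul _ _ m fun t _ => hm t).trans (Nat.mul_le_mul_right m ?_)
    rwa [← Set.ncard_eq_toFinset_card]
  obtain ⟨X, hX, hlt⟩ := exists_card_le_treedepth_induce_diff_lt (G := S) ⟨a, ha⟩
    (insert a (hfin.toFinset.biUnion D.bag)) fun c hc => by
      rcases mem_componentIn_or_exists_mem_bag hD hSG (hS a) hA ha htop hc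
        with h | ⟨u, hu, p, hp, hup⟩
      · exact ⟨a, Finset.mem_insert_self _ _, h⟩
      · exact ⟨u, Finset.mem_insert_of_mem
          (Finset.mem_biUnion.mpr ⟨p, hfin.mem_toFinset.mpr hp, hup⟩), hu⟩
  exact ⟨X, hX.trans hcard, hlt⟩

lemma treedepth_induce_tree_le (hD : D.IsGreedy) (hSG : S ≤ G)
    (hS : ∀ v, (S.induce {x | D.IsAncestor v x}).Connected) {l m : ℕ}
    (hm : ∀ t, (D.bag t).card ≤ m) (hl : 3 * m + 2 ≤ 2 ^ l) (hA : (D.tree.induce A).Connected)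
    (hbd : (innerBoundary D.tree A).ncard ≤ 3) :
    (D.tree.induce A).treedepth ≤ (S.induce A).treedepth * (l + 3) := by
  induction hd : (S.induce A).treedepth using Nat.strong_induction_on generalizing A with
  | _ d ih =>
  subst hd
  obtain ⟨X, hX, hlt⟩ := exists_card_le_mul_treedepth_induce_diff_lt hD hSG hS hm hA hbd
  have hpieces : ∀ K ⊆ A, (D.tree.induce K).Connected → Disjoint (X : Set V) K →
      (innerBoundary D.tree K).ncard ≤ 3 →
      (D.tree.induce K).treedepth ≤ ((S.induce A).treedepth - 1) * (l + 3) := by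
    intro K hKA hK hXK hKbd
    have hKlt : (S.induce K).treedepth < (S.induce A).treedepth :=
      (treedepth_induce_mono (Set.subset_sdiff.mpr ⟨hKA, hXK.symm⟩)).trans_lt hlt
    exact (ih _ hKlt hK hKbd rfl).trans (Nat.mul_le_mul_right _ (Nat.le_pred_of_lt hKlt))
  have hterm : (terminals D.tree X A).ncard ≤ 2 ^ l + 2 := by
    have hunion := Set.ncard_union_le ((X : Set V) ∩ A) (innerBoundary D.tree A)
    have hXA := Set.ncard_le_ncard (Set.inter_subset_left (s := (X : Set V)) (t := A))
    rw [Set.ncard_coe_finset] at hXA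
    exact hunion.trans (by omega)
  calc (D.tree.induce A).treedepth
      ≤ ((S.induce A).treedepth - 1) * (l + 3) + 3 + l :=
        treedepth_induce_le_of_ncard_terminals_le D.isTree.isAcyclic hpieces subset_rfl hA hterm
    _ = ((S.induce A).treedepth - 1 + 1) * (l + 3) := by ring
    _ = (S.induce A).treedepth * (l + 3) := by rw [Nat.sub_add_cancel (by omega)]

lemma treedepth_tree_le (hD : D.IsGreedy) (hSG : S ≤ G)
    (hS : ∀ v, (S.induce {x | D.IsAncestor v x}).Connected) {l m : ℕ}
    (hm : ∀ t, (D.bag t).card ≤ m) (hl : 3 * m + 2 ≤ 2 ^ l) :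
    D.tree.treedepth ≤ S.treedepth * (l + 3) := by
  have huniv := treedepth_induce_tree_le hD hSG hS hm hl
    (induce_univ_connected D.isTree.connected) (by simp [innerBoundary_univ])
  rwa [treedepth_induce_univ, treedepth_induce_univ] at huniv

end Greedy

section Conclusion

lemma exists_subcubic_subtree {V : Type u} [Finite V] {G S : SimpleGraph V} (hSG : S ≤ G)
    (hS : S.IsTree) :
    ∃ H : G.Subgraph, H.coe.IsTree ∧ (∀ x ∈ H.verts, (H.neighborSet x).ncard ≤ 3) ∧
      S.treedepth ≤ 2 * H.coe.treedepth := by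
  obtain ⟨X, hX, hdeg, htd⟩ := exists_subcubic_treedepth_le hS
  let H : G.Subgraph := (toSubgraph S hSG).induce X
  have hcoe : H.coe = S.induce X := by
    ext a b
    exact ⟨fun h => h.2.2, fun h => ⟨a.2, b.2, h⟩⟩
  refine ⟨H, hcoe ▸ ⟨hX, hS.isAcyclic.induce X⟩, fun x hx => ?_, hcoe ▸ htd⟩
  have hsub : H.neighborSet x ⊆ S.neighborSet x ∩ X := fun y hy => ⟨hy.2.2, hy.2.1⟩
  exact (Set.ncard_le_ncard hsub).trans (hdeg x hx)

lemma exists_le_two_pow_and_le_logb {τ : ℝ} (hτ : 2 ≤ τ) :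
    ∃ l : ℕ, 3 * ⌊τ⌋₊ + 2 ≤ 2 ^ l ∧ (l : ℝ) + 3 ≤ 7 * Real.logb 2 τ := by
  have hpos : 0 < τ := by linarith
  have hlog : 1 ≤ Real.logb 2 τ := by
    rw [Real.le_logb_iff_rpow_le one_lt_two hpos]
    simpa using hτ
  refine ⟨⌈Real.logb 2 τ⌉₊ + 2, ?_, ?_⟩
  · have hceil : τ ≤ 2 ^ ⌈Real.logb 2 τ⌉₊ := by
      rw [← Real.rpow_natCast, ← Real.logb_le_iff_le_rpow one_lt_two hpos]
      exact Nat.le_ceil _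
    have hfloor : (⌊τ⌋₊ : ℝ) ≤ 2 ^ ⌈Real.logb 2 τ⌉₊ := (Nat.floor_le hpos.le).trans hceil
    have hnat : ⌊τ⌋₊ ≤ 2 ^ ⌈Real.logb 2 τ⌉₊ := by exact_mod_cast hfloor
    have htwo : 2 ≤ ⌊τ⌋₊ := Nat.le_floor (by exact_mod_cast hτ)
    rw [pow_add]
    omega
  · have hceil := (Nat.ceil_lt_add_one (zero_le_one.trans hlog)).le
    push_cast
    linarith

end Conclusion

end GreedyTreedepth

open GreedyTreedepth in
theorem lemma7 :
    ∃ c : ℝ, 0 < c ∧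
      ∀ (V : Type u) [Finite V] (G : SimpleGraph V), G.Connected →
        ∀ D : G.TreeDecomposition V, D.IsGreedy →
          ∀ τ : ℝ, 2 ≤ τ → (∀ t : V, ((D.bag t).card : ℝ) ≤ τ) →
            ∃ H : G.Subgraph, H.coe.IsTree ∧
              (∀ x ∈ H.verts, (H.neighborSet x).ncard ≤ 3) ∧
              c * ((D.tree.treedepth : ℝ) / Real.logb 2 τ) ≤ (H.coe.treedepth : ℝ) := by
  refine ⟨1 / 14, by norm_num, fun V _ G _ D hD τ hτ hbag => ?_⟩
  obtain ⟨S, hSG, hS, hconn⟩ := exists_isTree_le_of_isGreedy hD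
  obtain ⟨l, hl, hlτ⟩ := exists_le_two_pow_and_le_logb hτ
  obtain ⟨H, hH, hdeg, htd⟩ := exists_subcubic_subtree hSG hS
  refine ⟨H, hH, hdeg, ?_⟩
  have hT : D.tree.treedepth ≤ S.treedepth * (l + 3) :=
    treedepth_tree_le hD hSG hconn (fun t => Nat.le_floor (hbag t)) hl
  have hlog : 0 < Real.logb 2 τ := Real.logb_pos one_lt_two (by linarith)
  rw [mul_div_assoc', div_le_iff₀ hlog]
  calc 1 / 14 * (D.tree.treedepth : ℝ)
      ≤ 1 / 14 * (S.treedepth * (l + 3)) := by gcongr; exact_mod_cast hT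
    _ ≤ 1 / 14 * ((2 * H.coe.treedepth) * (7 * Real.logb 2 τ)) := by gcongr; exact_mod_cast htd
    _ = H.coe.treedepth * Real.logb 2 τ := by ring
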